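/- Let $\Sigma=\{1,\dots,d\}$ be a finite token space, $\Delta(\Sigma)$ the set of probability distributions on $\Sigma$, and $\lambda$ the uniform distribution on $[0,1]$. Let $n>1$ be an integer and $\delta\in(0,1)$. A valid (distortion-free) selection kernel is a probability kernel $\kappa$ from $[0,1]\times\Delta(\Sigma)$ to $\Sigma$ such that $\int_0^1\kappa(\cdot\mid u,p)\,du=p$ for all $p\in\Delta(\Sigma)$. A probability measure $\xi$ on $\Delta(\Sigma)$ is symmetric if, when $P$ has law $\xi$, $P\circ\sigma$ has law $\xi$ for every permutation $\sigma$ of $\Sigma$. For $p:\Sigma\to[0,1]$, $\epsilon\in(0,1)$ and $q>0$ let $$p_\epsilon(a)=p(a)\mathbf 1(p(a)\le\epsilon),\qquad p_\epsilon^c(a)=p(a)\mathbf 1(p(a)>\epsilon),\qquad G^q(p)=\sum_{a\in\Sigma}\big(p(a)(1-p(a))\big)^q.$$ Let $\xi$ be a symmetric probability measure on $\Delta(\Sigma)$, $\kappa$ a valid selection kernel and $\kappa_0(\cdot\mid u,p)=p$. Let $\mathbb Q_0=\lambda\otimes\xi\otimes\kappa_0$ and $\mathbb Q_1=\lambda\otimes\xi\otimes\kappa$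 be the laws of $(U,P,A)$ with $U\sim\lambda$ and $P\sim\xi$ independent and $A$ drawn from $\kappa_0(\cdot\mid U,P)$, respectively $\kappa(\cdot\mid U,P)$. For $k\in\{0,1\}$ let $\mathbb P_k$ be the law of $(U_1,A_1,\dots,U_n,A_n)$ when the triples $(U_t,P_t,A_t)$, $1\le t\le n$, are i.i.d. with law $\mathbb Q_k$. Suppose that $T\in\{0,1\}$ is measurable with respect to $\mathcal F_n=\sigma(U_1,A_1,\dots,U_n,A_n)$ and that $\mathbb P_0(T=0)\ge1-\delta$ and $\mathbb P_1(T=1)\ge1-\delta$. Then, for every $\epsilon\in(0,1/2)$ and $P$ with law $\xi$, $$n\ \ge\ \min\left(\frac{1}{2\,\mathbb E[G^1(P_\epsilon)]},\ \frac{\log\left(\frac{1}{16\delta}\right)}{16\,\mathbb E\big[G^{1/2}(P_\epsilon^c)\big]^2}\right),$$ where $\mathbb E[\,\cdot\,]^2$ is the square of the expectation, and a quotient $x/0$ is read as $+\infty$ if $x>0$, $-\infty$ if $x<0$ and $0$ if $x=0$. -/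

import Mathlib

open MeasureTheory ProbabilityTheory

namespace Watermark

noncomputable section

/-- `Δ(Σ)` for the token space `Σ = Fin d`, with the σ-algebra inherited from `ℝ^d`. -/
abbrev Simplex (d : ℕ) : Type := stdSimplex ℝ (Fin d)

/-- The distribution on tokens with probability mass function `p`. -/
def tokenMeasure {d : ℕ} (p : Simplex d) : Measure (Fin d) :=
  ∑ a, ENNReal.ofReal (p.1 a) • Measure.dirac a

lemma tokenMeasure_apply {d : ℕ} (p : Simplex d) (s : Set (Fin d)) :
    tokenMeasure p s = ∑ a, ENNReal.ofReal (p.1 a) * s.indicator 1 a := by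
  simp [tokenMeasure, Measure.finsetSum_apply]

/-- The kernel `κ₀(· | u, p) = p` that ignores the noise `u`. -/
def nullKernel (d : ℕ) : Kernel (unitInterval × Simplex d) (Fin d) where
  toFun x := tokenMeasure x.2
  measurable' := by
    refine Measure.measurable_of_measurable_coe _ fun s _ => ?_
    simp only [tokenMeasure_apply]
    refine Finset.measurable_fun_sum _ fun a _ => Measurable.mul_const ?_ _
    exact ENNReal.measurable_ofReal.comp
      ((measurable_pi_apply a).comp (measurable_subtype_coe.comp measurable_snd))

instance nullKernel_isMarkovKernel (d : ℕ) : IsMarkovKernel (nullKernel d) where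
  isProbabilityMeasure x := ⟨by
    change tokenMeasure x.2 Set.univ = 1
    rw [tokenMeasure_apply]
    simp only [Set.indicator_univ, Pi.one_apply, mul_one]
    rw [← ENNReal.ofReal_sum_of_nonneg fun a _ => x.2.2.1 a, x.2.2.2, ENNReal.ofReal_one]⟩

/-- A probability kernel `κ` from `[0,1] × Δ(Σ)` to `Σ` is a valid (distortion-free) selection
kernel if `∫₀¹ κ(· | u, p) du = p` for every `p ∈ Δ(Σ)`. -/
def IsValidKernel {d : ℕ} (κ : Kernel (unitInterval × Simplex d) (Fin d)) : Prop :=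
  IsMarkovKernel κ ∧
    ∀ (p : Simplex d) (s : Set (Fin d)), ∫⁻ u : unitInterval, κ (u, p) s = tokenMeasure p s

/-- The distribution `p ∘ σ`. -/
def permute {d : ℕ} (σ : Equiv.Perm (Fin d)) (p : Simplex d) : Simplex d :=
  ⟨fun a => p.1 (σ a), fun a => p.2.1 (σ a), (Equiv.sum_comp σ p.1).trans p.2.2⟩

/-- `ξ` is symmetric if `P ∘ σ` has law `ξ` whenever `P` has law `ξ`. -/
def IsSymmetric {d : ℕ} (ξ : Measure (Simplex d)) : Prop :=
  ∀ σ : Equiv.Perm (Fin d), ξ.map (permute σ) = ξ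

/-- The joint law `λ ⊗ ξ ⊗ κ` of `((U, P), A)`, where `λ` is the uniform law on `[0,1]`. -/
def jointLaw {d : ℕ} (ξ : Measure (Simplex d))
    (κ : Kernel (unitInterval × Simplex d) (Fin d)) :
    Measure ((unitInterval × Simplex d) × Fin d) :=
  ((volume : Measure unitInterval).prod ξ) ⊗ₘ κ

/-- The law of the observations `(U₁, A₁), …, (Uₙ, Aₙ)` when the triples `(U_t, P_t, A_t)` are
i.i.d. with law `λ ⊗ ξ ⊗ κ`. -/
def obsLaw {d : ℕ} (n : ℕ) (ξ : Measure (Simplex d))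
    (κ : Kernel (unitInterval × Simplex d) (Fin d)) :
    Measure (Fin n → unitInterval × Fin d) :=
  (Measure.pi fun _ : Fin n => jointLaw ξ κ).map fun ω t => ((ω t).1.1, (ω t).2)

/-- `p_ε(a) = p(a) 1(p(a) ≤ ε)`. -/
def lowPart {d : ℕ} (ε : ℝ) (p : Fin d → ℝ) (a : Fin d) : ℝ :=
  if p a ≤ ε then p a else 0

/-- `p_ε^c(a) = p(a) 1(p(a) > ε)`. -/
def highPart {d : ℕ} (ε : ℝ) (p : Fin d → ℝ) (a : Fin d) : ℝ :=
  if ε < p a then p a else 0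

/-- `G^q(p) = ∑ₐ (p(a) (1 - p(a)))^q`. -/
def G {d : ℕ} (q : ℝ) (p : Fin d → ℝ) : ℝ :=
  ∑ a, (p a * (1 - p a)) ^ q

/-- The quotient `a / b` as an extended real number: the usual one for `b ≠ 0`, and
`+∞`, `0`, `-∞` for `b = 0` and `a > 0`, `a = 0`, `a < 0` respectively. -/
def extDiv (a b : ℝ) : EReal :=
  if b = 0 then (if 0 < a then ⊤ else if a < 0 then ⊥ else 0) else ((a / b : ℝ) : EReal)

end

end Watermark

open Watermark

/-!
By symmetry of `ξ`, a token under the null hypothesis is uniform on the `d` tokens and independent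
of `U`, and the observation law under `κ` has density `f(u, a) = d · 𝔼[κ(a | u, P)]` with respect to
the null law. Write `f = b + x`, where
`b = 1 + d · 𝔼[(κ(a | u, P) - P(a)) 1(P(a) > ε)]` and `x = d · 𝔼[(κ(a | u, P) - P(a)) 1(P(a) ≤ ε)]`.

The two parts are measured differently. As `κ(a | ·, p)` takes values in `[0, 1]` and has mean
`p(a)`, its mean absolute deviation is at most `2 p(a)(1 - p(a))` and its variance at most
`p(a)(1 - p(a))`. The first bound gives `∫ |x| ≤ 2 h` with `h = 𝔼[G¹(P_ε)]`, so `m = min(f, b)` has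
mass at least `1 - h` (`one_sub_le_integral_min`). The second, with Minkowski's integral inequality
and the symmetry of `ξ`, gives `∫ b² ≤ 1 + g²` with `g = 𝔼[G^{1/2}(P_ε^c)]`
(`integral_highRatio_sq_le`).

For `n` observations let `M = ∏ m(U_t, A_t)`, a lower bound for the likelihood ratio. If `n h ≤ 1/2`
then `∫ M ≥ (1 - h)^n ≥ 1/2`, while `∫ M² ≤ K = (1 + g²)^n`. The two error probabilities of the test
add up to at least `∫ min(M, 1) ≥ 1 / (4 K)` (`one_div_le_of_test_errors`), hence
`δ ≥ 1 / (8 (1 + g²)^n) ≥ exp(-n g²) / 8` (`one_div_le_error`), which is stronger than the second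
alternative. If `n h > 1/2`, the first alternative holds.
-/

namespace Watermark

/-! ### Product densities and testing errors -/

theorem pi_withDensity {ι α : Type*} [Fintype ι] [MeasurableSpace α] (μ : Measure α)
    [IsProbabilityMeasure μ] {f : α → ENNReal} (hf : Measurable f)
    [SigmaFinite (μ.withDensity f)] :
    Measure.pi (fun _ : ι => μ.withDensity f) =
      (Measure.pi fun _ : ι => μ).withDensity fun ω => ∏ i, f (ω i) := by
  refine Measure.pi_eq (μ := fun _ : ι => μ.withDensity f) fun s hs => ?_
  rw [withDensity_apply _ (MeasurableSet.univ_pi hs),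
    ← lintegral_indicator (MeasurableSet.univ_pi hs)]
  have hprod : ((Set.univ.pi s).indicator fun ω : ι → α => ∏ i, f (ω i)) =
      fun ω => ∏ i, (s i).indicator f (ω i) := by
    funext ω
    by_cases h : ω ∈ Set.univ.pi s
    · rw [Set.indicator_of_mem h]
      exact Finset.prod_congr rfl fun i _ => (Set.indicator_of_mem (h i trivial) f).symm
    · rw [Set.indicator_of_notMem h]
      obtain ⟨i, hi⟩ : ∃ i, ω i ∉ s i := by simpa [Set.mem_univ_pi] using h
      exact (Finset.prod_eq_zero (Finset.mem_univ i) (Set.indicator_of_notMem hi f)).symm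
  have hind := iIndepFun_pi (μ := fun _ : ι => μ) (X := fun i => (s i).indicator f)
    fun i => (hf.indicator (hs i)).aemeasurable
  have hmeas (i : ι) : Measurable fun ω : ι → α => (s i).indicator f (ω i) :=
    (hf.indicator (hs i)).comp (measurable_pi_apply i)
  rw [hprod, lintegral_prod_eq_prod_lintegral_of_indepFun _ _ hind hmeas]
  refine Finset.prod_congr rfl fun i _ => ?_
  rw [withDensity_apply _ (hs i), ← lintegral_indicator (hs i)]
  exact (measurePreserving_eval (fun _ : ι => μ) i).lintegral_comp (hf.indicator (hs i))

/-- A second-moment lower bound for the error of a test. Here `M` is a lower bound for the likelihood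
ratio, not itself a probability density: its mass only has to stay above `1 / 2`. -/
theorem one_div_le_of_test_errors {Ω : Type*} [MeasurableSpace Ω] (μ : Measure Ω)
    [IsProbabilityMeasure μ] {M : Ω → ℝ} (hM0 : ∀ ω, 0 ≤ M ω) (hM : Integrable M μ)
    (hM2 : Integrable (fun ω => M ω ^ 2) μ) {K : ℝ} (hK : 1 ≤ K)
    (hlow : 1 / 2 ≤ ∫ ω, M ω ∂μ) (hsq : ∫ ω, M ω ^ 2 ∂μ ≤ K) {S : Set Ω}
    (hS : MeasurableSet S) {δ : ℝ} (h0 : μ.real S ≤ δ) (h1 : ∫ ω in Sᶜ, M ω ∂μ ≤ δ) :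
    1 / (8 * K) ≤ δ := by
  have hKpos : 0 < K := by linarith
  have hK1 : 1 / K ≤ 1 := by rw [div_le_one hKpos]; exact hK
  have hKp : 0 < 1 / K := by positivity
  -- With `s = 1 / K ≤ 1` one has `s M - s² M² / 4 ≤ min M 1`, since
  -- `1 - (s M - s² M² / 4) = (1 - s M / 2)²`; this `s` maximises `s / 2 - s² K / 4`.
  have hint : Integrable (fun ω => 1 / K * M ω - (1 / K) ^ 2 / 4 * M ω ^ 2) μ :=
    (hM.const_mul _).sub (hM2.const_mul _)
  have hbound : ∫ ω, (1 / K * M ω - (1 / K) ^ 2 / 4 * M ω ^ 2) ∂μ ≤ 2 * δ := by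
    rw [← integral_add_compl hS hint]
    have hA : ∫ ω in S, (1 / K * M ω - (1 / K) ^ 2 / 4 * M ω ^ 2) ∂μ ≤ μ.real S := by
      have : ∫ ω in S, (1 : ℝ) ∂μ = μ.real S := by simp
      rw [← this]
      refine integral_mono hint.integrableOn (integrable_const _) fun ω => ?_
      simp only
      nlinarith [sq_nonneg (1 - 1 / K * M ω / 2)]
    have hB : ∫ ω in Sᶜ, (1 / K * M ω - (1 / K) ^ 2 / 4 * M ω ^ 2) ∂μ ≤ ∫ ω in Sᶜ, M ω ∂μ := by
      refine integral_mono hint.integrableOn hM.integrableOn fun ω => ?_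
      simp only
      nlinarith [mul_le_mul_of_nonneg_right hK1 (hM0 ω), sq_nonneg (1 / K * M ω)]
    linarith
  rw [integral_sub (hM.const_mul _) (hM2.const_mul _), integral_const_mul,
    integral_const_mul] at hbound
  have h3 : (1 / K) ^ 2 / 4 * ∫ ω, M ω ^ 2 ∂μ ≤ (1 / K) / 4 := by
    calc _ ≤ (1 / K) ^ 2 / 4 * K := by gcongr
      _ = _ := by field_simp
  have h4 : 1 / K * (1 / 2) ≤ 1 / K * ∫ ω, M ω ∂μ := by gcongr
  have h5 : 1 / (8 * K) = 1 / K / 8 := by field_simp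
  rw [h5]; linarith

/-! ### Integral inequalities -/

/-- Minkowski's integral inequality in `L²`, for bounded functions. It follows by duality: the square
of the norm `N` of `y = ∫ φ(·, b) dν(b)` equals `∫ ⟪y, φ(·, b)⟫ dν(b)`, which Cauchy–Schwarz bounds
by `N ∫ s dν`. -/
theorem integral_sq_integral_le {α β : Type*} [MeasurableSpace α] [MeasurableSpace β]
    (μ : Measure α) (ν : Measure β) [IsProbabilityMeasure μ] [IsProbabilityMeasure ν]
    {φ : α × β → ℝ} (hφ : Measurable φ) {C : ℝ} (hC : ∀ x, |φ x| ≤ C)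
    {s : β → ℝ} (hs : Integrable s ν) (hs0 : ∀ b, 0 ≤ s b)
    (hle : ∀ b, ∫ a, φ (a, b) ^ 2 ∂μ ≤ s b ^ 2) :
    ∫ a, (∫ b, φ (a, b) ∂ν) ^ 2 ∂μ ≤ (∫ b, s b ∂ν) ^ 2 := by
  set y : α → ℝ := fun a => ∫ b, φ (a, b) ∂ν with hy
  have hym : Measurable y := (hφ.stronglyMeasurable.integral_prod_right').measurable
  have hyC (a : α) : |y a| ≤ C := by
    have := norm_integral_le_of_norm_le_const (μ := ν) (f := fun b => φ (a, b)) (C := C)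
      (Filter.Eventually.of_forall fun b => hC (a, b))
    simpa using this
  have hy2 : MemLp y (ENNReal.ofReal 2) μ :=
    MemLp.of_bound hym.aestronglyMeasurable C (Filter.Eventually.of_forall hyC)
  set N : ℝ := √(∫ a, y a ^ 2 ∂μ) with hN
  have hNsq : N ^ 2 = ∫ a, y a ^ 2 ∂μ := Real.sq_sqrt (integral_nonneg fun a => sq_nonneg _)
  have hCS (b : β) : ∫ a, y a * φ (a, b) ∂μ ≤ N * s b := by
    have hφb : Measurable fun a => φ (a, b) := hφ.comp measurable_prodMk_right
    have hφ2 : MemLp (fun a => φ (a, b)) (ENNReal.ofReal 2) μ :=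
      MemLp.of_bound hφb.aestronglyMeasurable C (Filter.Eventually.of_forall fun a => hC (a, b))
    have h := integral_mul_norm_le_Lp_mul_Lq Real.HolderConjugate.two_two hy2 hφ2
    simp only [Real.norm_eq_abs, Real.rpow_two, sq_abs, ← Real.sqrt_eq_rpow] at h
    calc ∫ a, y a * φ (a, b) ∂μ ≤ ∫ a, |y a| * |φ (a, b)| ∂μ := by
          refine (le_abs_self _).trans (abs_integral_le_integral_abs.trans_eq ?_)
          simp only [abs_mul]
      _ ≤ N * √(∫ a, φ (a, b) ^ 2 ∂μ) := h
      _ ≤ N * s b := by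
          gcongr
          exact Real.sqrt_le_iff.2 ⟨hs0 b, hle b⟩
  have hint : Integrable (fun x : α × β => y x.1 * φ x) (μ.prod ν) := by
    refine Integrable.of_bound ((hym.comp measurable_fst).mul hφ).aestronglyMeasurable (C * C)
      (Filter.Eventually.of_forall fun x => ?_)
    rw [Real.norm_eq_abs, abs_mul]
    exact mul_le_mul (hyC _) (hC _) (abs_nonneg _) ((abs_nonneg _).trans (hyC x.1))
  have hkey : N ^ 2 ≤ N * ∫ b, s b ∂ν := by
    calc N ^ 2 = ∫ a, ∫ b, y a * φ (a, b) ∂ν ∂μ := by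
          rw [hNsq]; simp only [integral_const_mul, sq, hy]
      _ = ∫ b, ∫ a, y a * φ (a, b) ∂μ ∂ν := integral_integral_swap hint
      _ ≤ ∫ b, N * s b ∂ν := integral_mono hint.integral_prod_right (hs.const_mul N) hCS
      _ = _ := integral_const_mul _ _
  have hN0 : 0 ≤ N := Real.sqrt_nonneg _
  have hS0 : 0 ≤ ∫ b, s b ∂ν := integral_nonneg hs0
  rw [← hNsq]
  nlinarith [sq_nonneg (N - ∫ b, s b ∂ν)]

theorem integral_abs_integral_le {α β : Type*} [MeasurableSpace α] [MeasurableSpace β]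
    (μ : Measure α) (ν : Measure β) [SFinite μ] [SFinite ν]
    {φ : α × β → ℝ} (hφ : Integrable φ (μ.prod ν)) :
    ∫ a, |∫ b, φ (a, b) ∂ν| ∂μ ≤ ∫ b, ∫ a, |φ (a, b)| ∂μ ∂ν := by
  rw [← integral_integral_swap (f := fun a b => |φ (a, b)|) hφ.abs]
  exact integral_mono hφ.integral_prod_left.abs hφ.abs.integral_prod_left
    fun a => abs_integral_le_integral_abs

/-- Mean absolute deviation of a `[0, 1]`-valued variable: by convexity the Bernoulli variable with the
same mean is the worst case. -/
theorem integral_abs_sub_mean_le {α : Type*} [MeasurableSpace α] (μ : Measure α)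
    [IsProbabilityMeasure μ] {k : α → ℝ} (hk : Integrable k μ) (h0 : ∀ a, 0 ≤ k a)
    (h1 : ∀ a, k a ≤ 1) {w : ℝ} (hw : ∫ a, k a ∂μ = w) (hw0 : 0 ≤ w) (hw1 : w ≤ 1) :
    ∫ a, |k a - w| ∂μ ≤ 2 * (w * (1 - w)) := by
  have hint : Integrable (fun a => k a * (1 - 2 * w) + w) μ :=
    (hk.mul_const _).add (integrable_const _)
  calc ∫ a, |k a - w| ∂μ ≤ ∫ a, (k a * (1 - 2 * w) + w) ∂μ := by
        refine integral_mono (hk.sub (integrable_const w)).abs hint fun a => ?_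
        simp only
        -- `|t - w|` lies below its chord `t (1 - 2 w) + w` on `[0, 1]`.
        rw [abs_le]
        constructor <;> nlinarith [h0 a, h1 a, mul_nonneg (h0 a) hw0,
          mul_nonneg (sub_nonneg.2 (h1 a)) hw0, mul_nonneg (h0 a) (sub_nonneg.2 hw1),
          mul_nonneg (sub_nonneg.2 (h1 a)) (sub_nonneg.2 hw1)]
    _ = 2 * (w * (1 - w)) := by
        rw [integral_add (hk.mul_const _) (integrable_const _), integral_mul_const, hw]
        simp; ring

/-- A `[0, 1]`-valued variable with mean `w` has variance at most that of the Bernoulli law. -/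
theorem integral_sq_sub_mean_le {α : Type*} [MeasurableSpace α] (μ : Measure α)
    [IsProbabilityMeasure μ] {k : α → ℝ} (hk : Integrable k μ) (h0 : ∀ a, 0 ≤ k a)
    (h1 : ∀ a, k a ≤ 1) {w : ℝ} (hw : ∫ a, k a ∂μ = w) :
    ∫ a, (k a - w) ^ 2 ∂μ ≤ w * (1 - w) := by
  have hint : Integrable (fun a => k a * (1 - 2 * w) + w ^ 2) μ :=
    (hk.mul_const _).add (integrable_const _)
  calc ∫ a, (k a - w) ^ 2 ∂μ ≤ ∫ a, (k a * (1 - 2 * w) + w ^ 2) ∂μ := by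
        refine integral_mono_of_nonneg (Filter.Eventually.of_forall fun a => sq_nonneg _) hint
          (Filter.Eventually.of_forall fun a => ?_)
        simp only
        nlinarith [mul_nonneg (h0 a) (sub_nonneg.2 (h1 a))]
    _ = w * (1 - w) := by
        rw [integral_add (hk.mul_const _) (integrable_const _), integral_mul_const, hw]
        simp; ring

theorem integrable_of_abs_le_one {α : Type*} [MeasurableSpace α] (μ : Measure α)
    [IsFiniteMeasure μ] {φ : α → ℝ} (hφ : Measurable φ) (h : ∀ x, |φ x| ≤ 1) :
    Integrable φ μ :=
  Integrable.of_bound hφ.aestronglyMeasurable 1 (Filter.Eventually.of_forall h)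

/-! ### Coordinates of a random point of the simplex -/

variable {d : ℕ}

theorem simplex_le_one (p : Simplex d) (a : Fin d) : p.1 a ≤ 1 := by
  rw [← p.2.2]
  exact Finset.single_le_sum (fun b _ => p.2.1 b) (Finset.mem_univ a)

theorem measurable_simplex_apply (a : Fin d) : Measurable fun p : Simplex d => p.1 a :=
  (measurable_pi_apply a).comp measurable_subtype_coe

theorem measurable_permute (σ : Equiv.Perm (Fin d)) : Measurable (permute σ) :=
  Measurable.subtype_mk (measurable_pi_lambda _ fun a => measurable_simplex_apply (σ a))

theorem integral_apply_eq_of_isSymmetric {ξ : Measure (Simplex d)} (hξ : IsSymmetric ξ)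
    {F : ℝ → ℝ} (hF : Measurable F) (a b : Fin d) :
    ∫ p, F (p.1 a) ∂ξ = ∫ p, F (p.1 b) ∂ξ := by
  conv_rhs => rw [← hξ (Equiv.swap a b)]
  have hFb : Measurable fun p : Simplex d => F (p.1 b) := hF.comp (measurable_simplex_apply b)
  rw [integral_map (measurable_permute _).aemeasurable hFb.aestronglyMeasurable]
  simp [permute]

theorem card_mul_integral_apply {ξ : Measure (Simplex d)} (hξ : IsSymmetric ξ)
    {F : ℝ → ℝ} (hF : Measurable F) (hint : ∀ a, Integrable (fun p : Simplex d => F (p.1 a)) ξ)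
    (a : Fin d) : d * ∫ p, F (p.1 a) ∂ξ = ∫ p, ∑ b, F (p.1 b) ∂ξ := by
  rw [integral_finsetSum _ fun b _ => hint b,
    Finset.sum_congr rfl fun b _ => integral_apply_eq_of_isSymmetric hξ hF b a]
  simp

theorem tokenMeasure_singleton (p : Simplex d) (a : Fin d) :
    tokenMeasure p {a} = ENNReal.ofReal (p.1 a) := by
  rw [tokenMeasure_apply, Finset.sum_eq_single a]
  · simp
  · intro b _ hb; simp [hb]
  · simp

/-! ### The law of one observation -/

/-- The law of a single observation `(U, A)` when `((U, P), A)` has law `λ ⊗ ξ ⊗ κ`. -/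
noncomputable def oneStepLaw (ξ : Measure (Simplex d))
    (κ : Kernel (unitInterval × Simplex d) (Fin d)) : Measure (unitInterval × Fin d) :=
  (jointLaw ξ κ).map fun x => (x.1.1, x.2)

theorem measurable_obs :
    Measurable fun x : (unitInterval × Simplex d) × Fin d => (x.1.1, x.2) := by fun_prop

/-- The probability `κ(a | u, p)` as a real number, with `x = (u, p)`. -/
noncomputable def tokenProb (κ : Kernel (unitInterval × Simplex d) (Fin d)) (a : Fin d)
    (x : unitInterval × Simplex d) : ℝ := (κ x).real {a}

theorem measurable_tokenProb (κ : Kernel (unitInterval × Simplex d) (Fin d)) (a : Fin d) :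
    Measurable (tokenProb κ a) :=
  (κ.measurable_coe (measurableSet_singleton a)).ennreal_toReal

theorem tokenProb_nonneg (κ : Kernel (unitInterval × Simplex d) (Fin d)) (a : Fin d) (x) :
    0 ≤ tokenProb κ a x := measureReal_nonneg

/-- The density `d · 𝔼[κ(a | u, P)]` at `z = (u, a)` of the observation law under `κ` with respect to
the one under `κ₀`. By symmetry of `ξ`, the latter makes `A` uniform on the `d` tokens. -/
noncomputable def likelihoodRatio (ξ : Measure (Simplex d))
    (κ : Kernel (unitInterval × Simplex d) (Fin d)) (z : unitInterval × Fin d) : ℝ :=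
  d * ∫ p, tokenProb κ z.2 (z.1, p) ∂ξ

theorem likelihoodRatio_nonneg (ξ : Measure (Simplex d))
    (κ : Kernel (unitInterval × Simplex d) (Fin d)) (z) : 0 ≤ likelihoodRatio ξ κ z :=
  mul_nonneg (Nat.cast_nonneg _) (integral_nonneg fun _ => tokenProb_nonneg κ _ _)

theorem measurable_likelihoodRatio (ξ : Measure (Simplex d)) [IsProbabilityMeasure ξ]
    (κ : Kernel (unitInterval × Simplex d) (Fin d)) : Measurable (likelihoodRatio ξ κ) :=
  measurable_from_prod_countable_left fun a =>
    (((measurable_tokenProb κ a).stronglyMeasurable.integral_prod_right').measurable).const_mul _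

section Law
variable (ξ : Measure (Simplex d)) [IsProbabilityMeasure ξ]
  (κ : Kernel (unitInterval × Simplex d) (Fin d)) [IsMarkovKernel κ]

instance : IsProbabilityMeasure (jointLaw ξ κ) := by unfold jointLaw; infer_instance

instance : IsProbabilityMeasure (oneStepLaw ξ κ) :=
  Measure.isProbabilityMeasure_map measurable_obs.aemeasurable

theorem obsLaw_eq_pi (n : ℕ) : obsLaw n ξ κ = Measure.pi fun _ : Fin n => oneStepLaw ξ κ :=
  Measure.pi_map_pi (μ := fun _ : Fin n => jointLaw ξ κ) fun _ => measurable_obs.aemeasurable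

theorem tokenProb_le_one (a : Fin d) (x) : tokenProb κ a x ≤ 1 := measureReal_le_one

theorem integrable_tokenProb_left (a : Fin d) (u : unitInterval) :
    Integrable (fun p => tokenProb κ a (u, p)) ξ :=
  integrable_of_abs_le_one ξ ((measurable_tokenProb κ a).comp measurable_prodMk_left) fun p => by
    rw [abs_of_nonneg (tokenProb_nonneg κ a _)]; exact tokenProb_le_one κ a _

theorem integrable_tokenProb_right (a : Fin d) (p : Simplex d) :
    Integrable fun u : unitInterval => tokenProb κ a (u, p) :=
  integrable_of_abs_le_one _ ((measurable_tokenProb κ a).comp measurable_prodMk_right) fun u => by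
    rw [abs_of_nonneg (tokenProb_nonneg κ a _)]; exact tokenProb_le_one κ a _

theorem lintegral_oneStepLaw {F : unitInterval × Fin d → ENNReal} (hF : Measurable F) :
    ∫⁻ z, F z ∂(oneStepLaw ξ κ) =
      ∑ a, ∫⁻ u, ENNReal.ofReal (∫ p, tokenProb κ a (u, p) ∂ξ) * F (u, a) := by
  have hm (a : Fin d) : Measurable fun x : unitInterval × Simplex d => κ x {a} :=
    κ.measurable_coe (measurableSet_singleton a)
  have hFa (a : Fin d) : Measurable fun u : unitInterval => F (u, a) := by fun_prop
  have hpt (x : unitInterval × Simplex d) :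
      ∫⁻ a, F (x.1, a) ∂(κ x) = ∑ a, κ x {a} * F (x.1, a) := by
    rw [lintegral_fintype]; simp only [mul_comm]
  have hmF (a : Fin d) :
      Measurable fun x : unitInterval × Simplex d => κ x {a} * F (x.1, a) :=
    (hm a).mul ((hFa a).comp measurable_fst)
  rw [oneStepLaw, lintegral_map hF measurable_obs, jointLaw,
    Measure.lintegral_compProd (f := fun x : (unitInterval × Simplex d) × Fin d => F (x.1.1, x.2))
      (hF.comp measurable_obs)]
  simp only [hpt]
  rw [lintegral_finsetSum _ fun a _ => hmF a]
  refine Finset.sum_congr rfl fun a _ => ?_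
  rw [lintegral_prod _ (hmF a).aemeasurable]
  refine lintegral_congr fun u => ?_
  simp only
  have hmu : Measurable fun p : Simplex d => κ (u, p) {a} := (hm a).comp measurable_prodMk_left
  rw [lintegral_mul_const _ hmu]
  congr 1
  rw [ofReal_integral_eq_lintegral_ofReal
    (integrable_tokenProb_left ξ κ a u)
    (Filter.Eventually.of_forall fun p => tokenProb_nonneg κ a _)]
  refine lintegral_congr fun p => ?_
  rw [tokenProb, Measure.real, ENNReal.ofReal_toReal (measure_ne_top _ _)]

theorem tokenProb_nullKernel (a : Fin d) (x : unitInterval × Simplex d) :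
    tokenProb (nullKernel d) a x = x.2.1 a := by
  have h : nullKernel d x {a} = ENNReal.ofReal (x.2.1 a) := tokenMeasure_singleton x.2 a
  rw [tokenProb, Measure.real, h, ENNReal.toReal_ofReal (x.2.2.1 a)]

theorem integral_tokenProb (hκ : IsValidKernel κ) (p : Simplex d) (a : Fin d) :
    ∫ u : unitInterval, tokenProb κ a (u, p) = p.1 a := by
  have h := hκ.2 p {a}
  have hm : Measurable fun u : unitInterval => κ (u, p) {a} :=
    (κ.measurable_coe (measurableSet_singleton a)).comp measurable_prodMk_right
  unfold tokenProb Measure.real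
  rw [integral_toReal hm.aemeasurable
    (Filter.Eventually.of_forall fun u => measure_lt_top _ _), h, tokenMeasure_singleton,
    ENNReal.toReal_ofReal (p.2.1 a)]

theorem integrable_simplex_apply (a : Fin d) : Integrable (fun p : Simplex d => p.1 a) ξ :=
  Integrable.of_bound (measurable_simplex_apply a).aestronglyMeasurable 1
    (Filter.Eventually.of_forall fun p => by
      rw [Real.norm_eq_abs, abs_of_nonneg (p.2.1 a)]; exact simplex_le_one p a)

theorem card_mul_integral_coord {ξ : Measure (Simplex d)} [IsProbabilityMeasure ξ]
    (hξ : IsSymmetric ξ) (a : Fin d) : d * ∫ p, p.1 a ∂ξ = 1 := by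
  rw [card_mul_integral_apply (F := fun x => x) hξ measurable_id (fun b => integrable_simplex_apply ξ b) a]
  simp only [fun p : Simplex d => p.2.2]
  simp

theorem lintegral_oneStepLaw_null {ξ : Measure (Simplex d)} [IsProbabilityMeasure ξ]
    (hξ : IsSymmetric ξ) {F : unitInterval × Fin d → ENNReal} (hF : Measurable F) :
    ∫⁻ z, F z ∂(oneStepLaw ξ (nullKernel d)) =
      ∑ a, ∫⁻ u, ENNReal.ofReal (d : ℝ)⁻¹ * F (u, a) := by
  rw [lintegral_oneStepLaw ξ _ hF]
  refine Finset.sum_congr rfl fun a _ => ?_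
  simp only [tokenProb_nullKernel]
  rw [eq_inv_of_mul_eq_one_right (card_mul_integral_coord hξ a)]

theorem integral_oneStepLaw_null {ξ : Measure (Simplex d)} [IsProbabilityMeasure ξ]
    (hξ : IsSymmetric ξ) {F : unitInterval × Fin d → ℝ} (hF : Measurable F) (hF0 : ∀ z, 0 ≤ F z)
    {C : ℝ} (hC : ∀ z, F z ≤ C) :
    ∫ z, F z ∂(oneStepLaw ξ (nullKernel d)) = (d : ℝ)⁻¹ * ∑ a, ∫ u, F (u, a) := by
  have hFa (a : Fin d) : Measurable fun u : unitInterval => F (u, a) := by fun_prop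
  have hi (a : Fin d) : Integrable fun u : unitInterval => F (u, a) :=
    Integrable.of_bound (hFa a).aestronglyMeasurable C (Filter.Eventually.of_forall fun u => by
      rw [Real.norm_eq_abs, abs_of_nonneg (hF0 _)]; exact hC _)
  rw [integral_eq_lintegral_of_nonneg_ae (Filter.Eventually.of_forall hF0)
    hF.aestronglyMeasurable, lintegral_oneStepLaw_null hξ hF.ennreal_ofReal, Finset.mul_sum,
    ENNReal.toReal_sum]
  · refine Finset.sum_congr rfl fun a _ => ?_
    rw [lintegral_const_mul _ (hFa a).ennreal_ofReal, ENNReal.toReal_mul,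
      ENNReal.toReal_ofReal (by positivity),
      integral_eq_lintegral_of_nonneg_ae (Filter.Eventually.of_forall fun u => hF0 _)
        (hFa a).aestronglyMeasurable]
  · intro a _
    rw [lintegral_const_mul _ (hFa a).ennreal_ofReal,
      ← ofReal_integral_eq_lintegral_ofReal (hi a) (Filter.Eventually.of_forall fun u => hF0 _)]
    exact ENNReal.mul_ne_top ENNReal.ofReal_ne_top ENNReal.ofReal_ne_top

theorem oneStepLaw_eq_withDensity (hξ : IsSymmetric ξ) :
    oneStepLaw ξ κ = (oneStepLaw ξ (nullKernel d)).withDensity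
      fun z => ENNReal.ofReal (likelihoodRatio ξ κ z) := by
  have hf := (measurable_likelihoodRatio ξ κ).ennreal_ofReal
  ext s hs
  rw [withDensity_apply _ hs, ← lintegral_indicator hs,
    lintegral_oneStepLaw_null hξ (hf.indicator hs), ← lintegral_indicator_one hs,
    lintegral_oneStepLaw ξ κ (measurable_one.indicator hs)]
  refine Finset.sum_congr rfl fun a _ => lintegral_congr fun u => ?_
  have hd : (d : ℝ) ≠ 0 := by have := a.pos; positivity
  by_cases h : (u, a) ∈ s
  · rw [Set.indicator_of_mem h, Set.indicator_of_mem h, Pi.one_apply, mul_one,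
      ← ENNReal.ofReal_mul (by positivity), likelihoodRatio, inv_mul_cancel_left₀ hd]
  · simp [h]

end Law

/-! ### Low-mass and high-mass parts of the likelihood ratio -/

/-- The deviation `κ(a | u, p) - p(a)` where `p(a) ≤ ε`, and `0` elsewhere. -/
noncomputable def lowDev (κ : Kernel (unitInterval × Simplex d) (Fin d)) (ε : ℝ) (a : Fin d)
    (x : unitInterval × Simplex d) : ℝ :=
  if x.2.1 a ≤ ε then tokenProb κ a x - x.2.1 a else 0

/-- The deviation `κ(a | u, p) - p(a)` where `p(a) > ε`, and `0` elsewhere. -/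
noncomputable def highDev (κ : Kernel (unitInterval × Simplex d) (Fin d)) (ε : ℝ) (a : Fin d)
    (x : unitInterval × Simplex d) : ℝ :=
  if ε < x.2.1 a then tokenProb κ a x - x.2.1 a else 0

theorem measurable_lowDev (κ : Kernel (unitInterval × Simplex d) (Fin d)) (ε : ℝ) (a : Fin d) :
    Measurable (lowDev κ ε a) := by
  have h : Measurable fun x : unitInterval × Simplex d => x.2.1 a :=
    (measurable_simplex_apply a).comp measurable_snd
  exact Measurable.ite (measurableSet_le h measurable_const)
    ((measurable_tokenProb κ a).sub h) measurable_const

theorem measurable_highDev (κ : Kernel (unitInterval × Simplex d) (Fin d)) (ε : ℝ) (a : Fin d) :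
    Measurable (highDev κ ε a) := by
  have h : Measurable fun x : unitInterval × Simplex d => x.2.1 a :=
    (measurable_simplex_apply a).comp measurable_snd
  exact Measurable.ite (measurableSet_lt measurable_const h)
    ((measurable_tokenProb κ a).sub h) measurable_const

/-- The part of the likelihood ratio that only sees high-mass tokens: `κ(a | u, p)` is replaced by
`p(a)` where `p(a) ≤ ε`. -/
noncomputable def highRatio (ξ : Measure (Simplex d))
    (κ : Kernel (unitInterval × Simplex d) (Fin d)) (ε : ℝ) (z : unitInterval × Fin d) : ℝ :=
  1 + d * ∫ p, highDev κ ε z.2 (z.1, p) ∂ξ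

theorem measurable_highRatio (ξ : Measure (Simplex d)) [IsProbabilityMeasure ξ]
    (κ : Kernel (unitInterval × Simplex d) (Fin d)) (ε : ℝ) : Measurable (highRatio ξ κ ε) :=
  measurable_from_prod_countable_left fun a =>
    ((((measurable_highDev κ ε a).stronglyMeasurable.integral_prod_right').measurable).const_mul
      _).const_add _

section Markov
variable (ξ : Measure (Simplex d)) [IsProbabilityMeasure ξ]
  (κ : Kernel (unitInterval × Simplex d) (Fin d)) [IsMarkovKernel κ]

theorem abs_tokenProb_sub_le (a : Fin d) (x : unitInterval × Simplex d) :
    |tokenProb κ a x - x.2.1 a| ≤ 1 := by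
  rw [abs_le]
  constructor <;> linarith [tokenProb_nonneg κ a x, tokenProb_le_one κ a x, x.2.2.1 a,
    simplex_le_one x.2 a]

theorem abs_lowDev_le (ε : ℝ) (a : Fin d) (x) : |lowDev κ ε a x| ≤ 1 := by
  unfold lowDev; split_ifs
  · exact abs_tokenProb_sub_le κ a x
  · simp

theorem abs_highDev_le (ε : ℝ) (a : Fin d) (x) : |highDev κ ε a x| ≤ 1 := by
  unfold highDev; split_ifs
  · exact abs_tokenProb_sub_le κ a x
  · simp

theorem integrable_highDev_left (ε : ℝ) (a : Fin d) (u : unitInterval) :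
    Integrable (fun p => highDev κ ε a (u, p)) ξ :=
  integrable_of_abs_le_one ξ ((measurable_highDev κ ε a).comp measurable_prodMk_left)
    fun _ => abs_highDev_le κ ε a _

theorem integrable_lowDev_left (ε : ℝ) (a : Fin d) (u : unitInterval) :
    Integrable (fun p => lowDev κ ε a (u, p)) ξ :=
  integrable_of_abs_le_one ξ ((measurable_lowDev κ ε a).comp measurable_prodMk_left)
    fun _ => abs_lowDev_le κ ε a _

variable {ξ}

theorem likelihoodRatio_eq_add (hξ : IsSymmetric ξ) (ε : ℝ) (u : unitInterval) (a : Fin d) :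
    likelihoodRatio ξ κ (u, a) =
      highRatio ξ κ ε (u, a) + d * ∫ p, lowDev κ ε a (u, p) ∂ξ := by
  have hsum : Integrable (fun p => p.1 a + highDev κ ε a (u, p)) ξ :=
    (integrable_simplex_apply ξ a).add (integrable_highDev_left ξ κ ε a u)
  rw [likelihoodRatio, highRatio, ← card_mul_integral_coord hξ a, ← mul_add, ← mul_add,
    ← integral_add (integrable_simplex_apply ξ a) (integrable_highDev_left ξ κ ε a u),
    ← integral_add hsum (integrable_lowDev_left ξ κ ε a u)]
  congr 1
  refine integral_congr_ae (Filter.Eventually.of_forall fun p => ?_)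
  simp only [highDev, lowDev]
  rcases le_or_gt (p.1 a) ε with h | h
  · simp [h, not_lt.2 h]
  · simp [h, not_le.2 h]

theorem highRatio_nonneg (hξ : IsSymmetric ξ) (ε : ℝ) (z : unitInterval × Fin d) :
    0 ≤ highRatio ξ κ ε z := by
  obtain ⟨u, a⟩ := z
  rw [highRatio, ← card_mul_integral_coord hξ a, ← mul_add,
    ← integral_add (integrable_simplex_apply ξ a) (integrable_highDev_left ξ κ ε a u)]
  refine mul_nonneg (Nat.cast_nonneg _) (integral_nonneg fun p => ?_)
  simp only [highDev]
  split_ifs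
  · simpa using tokenProb_nonneg κ a (u, p)
  · simpa using p.2.1 a

theorem highRatio_le (ε : ℝ) (z : unitInterval × Fin d) : highRatio ξ κ ε z ≤ 1 + d := by
  have h : ∫ p, highDev κ ε z.2 (z.1, p) ∂ξ ≤ ∫ _ : Simplex d, (1 : ℝ) ∂ξ :=
    integral_mono (integrable_highDev_left ξ κ ε z.2 z.1) (integrable_const 1)
      fun p => (le_abs_self _).trans (abs_highDev_le κ ε _ _)
  have h1 : ∫ p, highDev κ ε z.2 (z.1, p) ∂ξ ≤ 1 := by simpa using h
  have := mul_le_mul_of_nonneg_left h1 (Nat.cast_nonneg (α := ℝ) d)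
  rw [highRatio]; linarith

theorem integral_highDev_fst (hκ : IsValidKernel κ) (ε : ℝ) (a : Fin d) (p : Simplex d) :
    ∫ u : unitInterval, highDev κ ε a (u, p) = 0 := by
  by_cases h : ε < p.1 a
  · simp only [highDev, h, if_true]
    rw [integral_sub (integrable_tokenProb_right κ a p) (integrable_const _),
      integral_tokenProb κ hκ p a]
    simp
  · simp [highDev, h]

theorem integral_likelihoodRatio (hξ : IsSymmetric ξ) (hκ : IsValidKernel κ) (a : Fin d) :
    ∫ u : unitInterval, likelihoodRatio ξ κ (u, a) = 1 := by
  simp only [likelihoodRatio]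
  rw [integral_const_mul, integral_integral_swap
    (f := fun (u : unitInterval) (p : Simplex d) => tokenProb κ a (u, p))
    (integrable_of_abs_le_one _ (measurable_tokenProb κ a) fun x =>
      (abs_of_nonneg (tokenProb_nonneg κ a x)).trans_le (tokenProb_le_one κ a x))]
  simp only [integral_tokenProb κ hκ]
  exact card_mul_integral_coord hξ a

theorem integral_integral_highDev (hκ : IsValidKernel κ) (ε : ℝ) (a : Fin d) :
    ∫ u : unitInterval, ∫ p, highDev κ ε a (u, p) ∂ξ = 0 := by
  rw [integral_integral_swap
    (f := fun (u : unitInterval) (p : Simplex d) => highDev κ ε a (u, p))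
    (integrable_of_abs_le_one _ (measurable_highDev κ ε a) (abs_highDev_le κ ε a))]
  simp [integral_highDev_fst κ hκ]

theorem measurable_lowPart (ε : ℝ) (a : Fin d) :
    Measurable fun p : Simplex d => lowPart ε p.1 a :=
  Measurable.ite (measurableSet_le (measurable_simplex_apply a) measurable_const)
    (measurable_simplex_apply a) measurable_const

theorem measurable_highPart (ε : ℝ) (a : Fin d) :
    Measurable fun p : Simplex d => highPart ε p.1 a :=
  Measurable.ite (measurableSet_lt measurable_const (measurable_simplex_apply a))
    (measurable_simplex_apply a) measurable_const

theorem lowPart_mem (ε : ℝ) (a : Fin d) (p : Simplex d) :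
    0 ≤ lowPart ε p.1 a ∧ lowPart ε p.1 a ≤ 1 := by
  unfold lowPart; split_ifs
  · exact ⟨p.2.1 a, simplex_le_one p a⟩
  · simp

theorem highPart_mem (ε : ℝ) (a : Fin d) (p : Simplex d) :
    0 ≤ highPart ε p.1 a ∧ highPart ε p.1 a ≤ 1 := by
  unfold highPart; split_ifs
  · exact ⟨p.2.1 a, simplex_le_one p a⟩
  · simp

variable (ξ) in
theorem integrable_lowPart_var (ε : ℝ) (a : Fin d) :
    Integrable (fun p : Simplex d => lowPart ε p.1 a * (1 - lowPart ε p.1 a)) ξ := by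
  have := measurable_lowPart ε a
  refine integrable_of_abs_le_one ξ (by fun_prop) fun p => ?_
  obtain ⟨h0, h1⟩ := lowPart_mem ε a p
  rw [abs_le]; constructor <;> nlinarith

variable (ξ) in
theorem integrable_sqrt_highPart_var (ε : ℝ) (a : Fin d) :
    Integrable (fun p : Simplex d => √(highPart ε p.1 a * (1 - highPart ε p.1 a))) ξ := by
  have := measurable_highPart ε a
  refine integrable_of_abs_le_one ξ (by fun_prop) fun p => ?_
  obtain ⟨h0, h1⟩ := highPart_mem ε a p
  rw [abs_of_nonneg (Real.sqrt_nonneg _)]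
  exact Real.sqrt_le_iff.2 ⟨zero_le_one, by nlinarith⟩

theorem integral_abs_integral_lowDev_le (hκ : IsValidKernel κ) (ε : ℝ) (a : Fin d) :
    ∫ u : unitInterval, |∫ p, lowDev κ ε a (u, p) ∂ξ| ≤
      2 * ∫ p, lowPart ε p.1 a * (1 - lowPart ε p.1 a) ∂ξ := by
  have hint : Integrable (lowDev κ ε a) ((volume : Measure unitInterval).prod ξ) :=
    integrable_of_abs_le_one _ (measurable_lowDev κ ε a) (abs_lowDev_le κ ε a)
  refine (integral_abs_integral_le _ ξ hint).trans ?_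
  rw [← integral_const_mul]
  refine integral_mono hint.abs.integral_prod_right
    ((integrable_lowPart_var ξ ε a).const_mul 2) fun p => ?_
  by_cases h : p.1 a ≤ ε
  · simp only [lowDev, lowPart, h, if_true]
    exact integral_abs_sub_mean_le _ (integrable_tokenProb_right κ a p)
      (fun _ => tokenProb_nonneg κ a _) (fun _ => tokenProb_le_one κ a _)
      (integral_tokenProb κ hκ p a) (p.2.1 a) (simplex_le_one p a)
  · simp [lowDev, lowPart, h]

theorem integral_sq_integral_highDev_le (hκ : IsValidKernel κ) (ε : ℝ) (a : Fin d) :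
    ∫ u : unitInterval, (∫ p, highDev κ ε a (u, p) ∂ξ) ^ 2 ≤
      (∫ p, √(highPart ε p.1 a * (1 - highPart ε p.1 a)) ∂ξ) ^ 2 := by
  refine integral_sq_integral_le _ ξ (measurable_highDev κ ε a) (abs_highDev_le κ ε a)
    (integrable_sqrt_highPart_var ξ ε a) (fun p => Real.sqrt_nonneg _) fun p => ?_
  obtain ⟨h0, h1⟩ := highPart_mem ε a p
  rw [Real.sq_sqrt (mul_nonneg h0 (sub_nonneg.2 h1))]
  by_cases h : ε < p.1 a
  · simp only [highDev, highPart, h, if_true]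
    exact integral_sq_sub_mean_le _ (integrable_tokenProb_right κ a p)
      (fun _ => tokenProb_nonneg κ a _) (fun _ => tokenProb_le_one κ a _)
      (integral_tokenProb κ hκ p a)
  · simp [highDev, highPart, h]

/-- The second moment of the high-mass ratio. Symmetry makes the `d` summands of `G` contribute
equally to the expectation, so that Minkowski's bound `𝔼[√(p(a)(1 - p(a)))]` for a single token is
exactly `1 / d` of the expected `G`. -/
theorem integral_highRatio_sq_le (hξ : IsSymmetric ξ) (hκ : IsValidKernel κ) (ε : ℝ) :
    ∫ z, highRatio ξ κ ε z ^ 2 ∂(oneStepLaw ξ (nullKernel d)) ≤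
      1 + (∫ p : Simplex d, G (1 / 2) (highPart ε p.1) ∂ξ) ^ 2 := by
  have hmeas := measurable_highRatio ξ κ ε
  rw [integral_oneStepLaw_null hξ (hmeas.pow_const 2) (fun _ => sq_nonneg _) (C := (1 + d) ^ 2)
    fun z => pow_le_pow_left₀ (highRatio_nonneg κ hξ ε z) (highRatio_le κ ε z) 2]
  set g := ∫ p : Simplex d, G (1 / 2) (highPart ε p.1) ∂ξ with hg
  have hsym (a : Fin d) :
      d * ∫ p, √(highPart ε p.1 a * (1 - highPart ε p.1 a)) ∂ξ = g := by
    have hF : Measurable fun t : ℝ =>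
        √((if ε < t then t else 0) * (1 - (if ε < t then t else 0))) := by
      have : Measurable fun t : ℝ => if ε < t then t else 0 :=
        Measurable.ite measurableSet_Ioi measurable_id measurable_const
      fun_prop
    rw [hg]
    simp only [G, ← Real.sqrt_eq_rpow]
    exact card_mul_integral_apply hξ hF (fun b => integrable_sqrt_highPart_var ξ ε b) a
  have hone (a : Fin d) : ∫ u : unitInterval, highRatio ξ κ ε (u, a) ^ 2 ≤ 1 + g ^ 2 := by
    set y : unitInterval → ℝ := fun u => ∫ p, highDev κ ε a (u, p) ∂ξ with hy
    have hym : Measurable y :=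
      ((measurable_highDev κ ε a).stronglyMeasurable.integral_prod_right').measurable
    have hyb (u : unitInterval) : |y u| ≤ 1 := by
      have := norm_integral_le_of_norm_le_const (μ := ξ) (f := fun p => highDev κ ε a (u, p))
        (C := 1) (Filter.Eventually.of_forall fun p => abs_highDev_le κ ε a _)
      simpa using this
    have hyi : Integrable y := integrable_of_abs_le_one _ hym hyb
    have hy2 : Integrable fun u => y u ^ 2 :=
      integrable_of_abs_le_one _ (hym.pow_const 2) fun u => by
        rw [abs_pow]; exact pow_le_one₀ (abs_nonneg _) (hyb u)
    have hexp : ∀ u : unitInterval,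
        highRatio ξ κ ε (u, a) ^ 2 = 1 + 2 * d * y u + d ^ 2 * y u ^ 2 := fun u => by
      simp only [highRatio, hy]; ring
    simp only [hexp]
    have hlin : Integrable fun u => 1 + 2 * d * y u := (integrable_const _).add (hyi.const_mul _)
    rw [integral_add hlin (hy2.const_mul _),
      integral_add (integrable_const _) (hyi.const_mul _), integral_const_mul,
      integral_const_mul, integral_integral_highDev κ hκ]
    have h := mul_le_mul_of_nonneg_left (integral_sq_integral_highDev_le (ξ := ξ) κ hκ ε a)
      (sq_nonneg (d : ℝ))
    rw [← mul_pow, hsym a] at h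
    simpa using h
  calc (d : ℝ)⁻¹ * ∑ a, ∫ u : unitInterval, highRatio ξ κ ε (u, a) ^ 2
      ≤ (d : ℝ)⁻¹ * ∑ _a : Fin d, (1 + g ^ 2) := by gcongr with a _; exact hone a
    _ = ((d : ℝ)⁻¹ * d) * (1 + g ^ 2) := by simp; ring
    _ ≤ 1 * (1 + g ^ 2) := by gcongr; exact inv_mul_le_one
    _ = 1 + g ^ 2 := one_mul _

/-- Truncating the likelihood ratio at the high-mass ratio `b` costs little mass: both integrate to
`1`, so the loss is half the `L¹` norm of their difference, the low-mass deviation. -/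
theorem one_sub_le_integral_min (hξ : IsSymmetric ξ) (hκ : IsValidKernel κ) (ε : ℝ) :
    1 - ∫ p : Simplex d, G 1 (lowPart ε p.1) ∂ξ ≤
      ∫ z, min (likelihoodRatio ξ κ z) (highRatio ξ κ ε z) ∂(oneStepLaw ξ (nullKernel d)) := by
  have hbm := measurable_highRatio ξ κ ε
  have hfm := measurable_likelihoodRatio ξ κ
  rw [integral_oneStepLaw_null hξ (hfm.min hbm)
    (fun z => le_min (likelihoodRatio_nonneg ξ κ z) (highRatio_nonneg κ hξ ε z)) (C := 1 + d)
    fun z => (min_le_right _ _).trans (highRatio_le κ ε z)]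
  have hone (a : Fin d) : 1 - d * ∫ p, lowPart ε p.1 a * (1 - lowPart ε p.1 a) ∂ξ ≤
      ∫ u : unitInterval, min (likelihoodRatio ξ κ (u, a)) (highRatio ξ κ ε (u, a)) := by
    have hxi : Integrable fun u : unitInterval => ∫ p, lowDev κ ε a (u, p) ∂ξ :=
      Integrable.integral_prod_left (integrable_of_abs_le_one
        ((volume : Measure unitInterval).prod ξ) (measurable_lowDev κ ε a) (abs_lowDev_le κ ε a))
    have hyi : Integrable fun u : unitInterval => ∫ p, highDev κ ε a (u, p) ∂ξ :=
      Integrable.integral_prod_left (integrable_of_abs_le_one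
        ((volume : Measure unitInterval).prod ξ) (measurable_highDev κ ε a)
        (abs_highDev_le κ ε a))
    have hb1 : ∫ u : unitInterval, highRatio ξ κ ε (u, a) = 1 := by
      simp only [highRatio]
      rw [integral_add (integrable_const _) (hyi.const_mul _), integral_const_mul,
        integral_integral_highDev κ hκ]
      simp
    have hbi : Integrable fun u : unitInterval => highRatio ξ κ ε (u, a) :=
      (integrable_const _).add (hyi.const_mul _)
    have hf1 := integral_likelihoodRatio κ hξ hκ a
    have hfi : Integrable fun u : unitInterval => likelihoodRatio ξ κ (u, a) := by
      simp only [likelihoodRatio_eq_add κ hξ ε]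
      exact hbi.add (hxi.const_mul _)
    have hmin (u : unitInterval) :
        min (likelihoodRatio ξ κ (u, a)) (highRatio ξ κ ε (u, a)) =
          (1 / 2) * (likelihoodRatio ξ κ (u, a) + highRatio ξ κ ε (u, a)
            - d * |∫ p, lowDev κ ε a (u, p) ∂ξ|) := by
      have hx : d * |∫ p, lowDev κ ε a (u, p) ∂ξ| =
          |likelihoodRatio ξ κ (u, a) - highRatio ξ κ ε (u, a)| := by
        rw [likelihoodRatio_eq_add κ hξ ε, add_sub_cancel_left, abs_mul, Nat.abs_cast]
      rw [hx]
      rcases le_total (likelihoodRatio ξ κ (u, a)) (highRatio ξ κ ε (u, a)) with h | h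
      · rw [min_eq_left h, abs_of_nonpos (sub_nonpos.2 h)]; ring
      · rw [min_eq_right h, abs_of_nonneg (sub_nonneg.2 h)]; ring
    simp only [hmin]
    have hfb : Integrable fun u : unitInterval =>
        likelihoodRatio ξ κ (u, a) + highRatio ξ κ ε (u, a) := hfi.add hbi
    rw [integral_const_mul, integral_sub hfb (hxi.abs.const_mul _),
      integral_add hfi hbi, hf1, hb1, integral_const_mul]
    have h := mul_le_mul_of_nonneg_left (integral_abs_integral_lowDev_le (ξ := ξ) κ hκ ε a)
      (Nat.cast_nonneg (α := ℝ) d)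
    linarith
  have hG : ∫ p : Simplex d, G 1 (lowPart ε p.1) ∂ξ =
      ∑ a, ∫ p, lowPart ε p.1 a * (1 - lowPart ε p.1 a) ∂ξ := by
    simp only [G, Real.rpow_one]
    exact integral_finsetSum _ fun a _ => integrable_lowPart_var ξ ε a
  have hd : (d : ℝ) ≠ 0 := by
    rintro h0
    obtain ⟨p⟩ : Nonempty (Simplex d) := nonempty_of_isProbabilityMeasure ξ
    have hp := p.2.2
    rw [Nat.cast_eq_zero] at h0
    subst h0
    simp at hp
  calc 1 - ∫ p : Simplex d, G 1 (lowPart ε p.1) ∂ξ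
      = (d : ℝ)⁻¹ * ∑ a : Fin d, (1 - d * ∫ p, lowPart ε p.1 a * (1 - lowPart ε p.1 a) ∂ξ) := by
        rw [hG, Finset.sum_sub_distrib, ← Finset.mul_sum, mul_sub, inv_mul_cancel_left₀ hd]
        simp [hd]
    _ ≤ _ := by gcongr with a _; exact hone a

end Markov

/-! ### Errors of a test based on `n` observations -/

/-- A pointwise lower bound for the likelihood ratio of one step tensorizes. -/
theorem setIntegral_prod_le_obsLaw {d : ℕ} {ξ : Measure (Simplex d)} [IsProbabilityMeasure ξ]
    (hξ : IsSymmetric ξ) (κ : Kernel (unitInterval × Simplex d) (Fin d)) [IsMarkovKernel κ] (n : ℕ)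
    {m : unitInterval × Fin d → ℝ} (hm : Measurable m) (hm0 : ∀ z, 0 ≤ m z)
    (hle : ∀ z, m z ≤ likelihoodRatio ξ κ z) {S : Set (Fin n → unitInterval × Fin d)}
    (hS : MeasurableSet S) :
    ∫ ω in S, ∏ t, m (ω t) ∂(Measure.pi fun _ : Fin n => oneStepLaw ξ (nullKernel d)) ≤
      (obsLaw n ξ κ).real S := by
  have hMm : Measurable fun ω : Fin n → unitInterval × Fin d => ∏ t, m (ω t) := by fun_prop
  have hwd := oneStepLaw_eq_withDensity ξ κ hξ
  have : SigmaFinite ((oneStepLaw ξ (nullKernel d)).withDensity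
      fun z => ENNReal.ofReal (likelihoodRatio ξ κ z)) := hwd ▸ inferInstance
  have hpi : obsLaw n ξ κ = (Measure.pi fun _ : Fin n => oneStepLaw ξ (nullKernel d)).withDensity
      fun ω => ∏ t, ENNReal.ofReal (likelihoodRatio ξ κ (ω t)) := by
    rw [obsLaw_eq_pi]
    simp only [hwd]
    exact pi_withDensity _ (measurable_likelihoodRatio ξ κ).ennreal_ofReal
  have hfin : obsLaw n ξ κ S ≠ ⊤ := by
    rw [obsLaw_eq_pi]; exact measure_ne_top _ _
  rw [integral_eq_lintegral_of_nonneg_ae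
    (Filter.Eventually.of_forall fun ω => Finset.prod_nonneg fun t _ => hm0 _)
    hMm.aestronglyMeasurable, Measure.real]
  refine ENNReal.toReal_mono hfin ?_
  rw [hpi, withDensity_apply _ hS]
  refine lintegral_mono fun ω => ?_
  rw [ENNReal.ofReal_prod_of_nonneg fun t _ => hm0 _]
  exact Finset.prod_le_prod' fun t _ => ENNReal.ofReal_le_ofReal (hle _)

/-- If `n` observations are too few for the low-mass tokens to matter, the error probability of a
test is bounded below through the second moment of the high-mass ratio alone. -/
theorem one_div_le_error {d n : ℕ} {δ : ℝ} {ξ : Measure (Simplex d)} [IsProbabilityMeasure ξ]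
    (hξ : IsSymmetric ξ) {κ : Kernel (unitInterval × Simplex d) (Fin d)} (hκ : IsValidKernel κ)
    {T : (Fin n → unitInterval × Fin d) → Fin 2} (hT : Measurable T)
    (h0 : 1 - δ ≤ (obsLaw n ξ (nullKernel d)).real {x | T x = 0})
    (h1 : 1 - δ ≤ (obsLaw n ξ κ).real {x | T x = 1}) (ε : ℝ)
    (hh1 : ∫ p : Simplex d, G 1 (lowPart ε p.1) ∂ξ ≤ 1)
    (hn : n * ∫ p : Simplex d, G 1 (lowPart ε p.1) ∂ξ ≤ 1 / 2) :
    1 / (8 * (1 + (∫ p : Simplex d, G (1 / 2) (highPart ε p.1) ∂ξ) ^ 2) ^ n) ≤ δ := by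
  have := hκ.1
  set Q := oneStepLaw ξ (nullKernel d) with hQ
  set m : unitInterval × Fin d → ℝ :=
    fun z => min (likelihoodRatio ξ κ z) (highRatio ξ κ ε z) with hm
  have hmm : Measurable m := (measurable_likelihoodRatio ξ κ).min (measurable_highRatio ξ κ ε)
  have hm0 (z) : 0 ≤ m z := le_min (likelihoodRatio_nonneg ξ κ z) (highRatio_nonneg κ hξ ε z)
  have hmC (z) : m z ≤ 1 + d := (min_le_right _ _).trans (highRatio_le κ ε z)
  have hMm : Measurable fun ω : Fin n → unitInterval × Fin d => ∏ t, m (ω t) := by fun_prop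
  have hM0 (ω : Fin n → unitInterval × Fin d) : 0 ≤ ∏ t, m (ω t) :=
    Finset.prod_nonneg fun t _ => hm0 _
  have hMC (ω : Fin n → unitInterval × Fin d) : ∏ t, m (ω t) ≤ (1 + d : ℝ) ^ n := by
    refine (Finset.prod_le_prod (fun t _ => hm0 (ω t)) fun t _ => hmC (ω t)).trans_eq ?_
    simp
  have hcompl : {x | T x = 1}ᶜ = {x | T x = 0} := by
    ext x
    simp only [Set.mem_compl_iff, Set.mem_ofPred_eq]
    generalize T x = i
    fin_cases i <;> simp
  have hS : MeasurableSet {x | T x = 1} := hT (measurableSet_singleton 1)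
  refine one_div_le_of_test_errors (Measure.pi fun _ : Fin n => Q)
    (M := fun ω => ∏ t, m (ω t)) hM0 ?_ ?_
    (one_le_pow₀ (le_add_of_nonneg_right (sq_nonneg _))) ?_ ?_ hS ?_ ?_
  · refine Integrable.of_bound hMm.aestronglyMeasurable ((1 + d : ℝ) ^ n)
      (Filter.Eventually.of_forall fun ω => ?_)
    rw [Real.norm_eq_abs, abs_of_nonneg (hM0 ω)]
    exact hMC ω
  · refine Integrable.of_bound (hMm.pow_const 2).aestronglyMeasurable (((1 + d : ℝ) ^ n) ^ 2)
      (Filter.Eventually.of_forall fun ω => ?_)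
    rw [Real.norm_eq_abs, abs_of_nonneg (sq_nonneg _)]
    exact pow_le_pow_left₀ (hM0 ω) (hMC ω) 2
  · rw [integral_fintype_prod_eq_pow, Fintype.card_fin]
    have hQm := one_sub_le_integral_min κ hξ hκ ε
    set h := ∫ p : Simplex d, G 1 (lowPart ε p.1) ∂ξ
    -- Bernoulli's inequality
    calc (1 / 2 : ℝ) ≤ 1 + n * (-h) := by linarith
      _ ≤ (1 + -h) ^ n := one_add_mul_le_pow (by linarith) n
      _ ≤ (∫ z, m z ∂Q) ^ n := by
        refine pow_le_pow_left₀ (by linarith) ?_ n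
        rw [← sub_eq_add_neg]; exact hQm
  · simp only [← Finset.prod_pow]
    rw [integral_fintype_prod_eq_pow (fun z => m z ^ 2), Fintype.card_fin]
    refine pow_le_pow_left₀ (integral_nonneg fun _ => sq_nonneg _) ?_ n
    refine le_trans ?_ (integral_highRatio_sq_le κ hξ hκ ε)
    refine integral_mono_of_nonneg (Filter.Eventually.of_forall fun _ => sq_nonneg _) ?_
      (Filter.Eventually.of_forall fun z => pow_le_pow_left₀ (hm0 z) (min_le_right _ _) 2)
    refine Integrable.of_bound ((measurable_highRatio ξ κ ε).pow_const 2).aestronglyMeasurable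
      ((1 + d : ℝ) ^ 2) (Filter.Eventually.of_forall fun z => ?_)
    rw [Real.norm_eq_abs, abs_of_nonneg (sq_nonneg _)]
    exact pow_le_pow_left₀ (highRatio_nonneg κ hξ ε z) (highRatio_le κ ε z) 2
  · rw [obsLaw_eq_pi, ← hcompl, probReal_compl_eq_one_sub hS] at h0
    linarith
  · have h := setIntegral_prod_le_obsLaw hξ κ n hmm hm0 (fun z => min_le_left _ _) hS.compl
    have hprob : IsProbabilityMeasure (obsLaw n ξ κ) := by rw [obsLaw_eq_pi]; infer_instance
    rw [probReal_compl_eq_one_sub hS] at h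
    linarith

end Watermark

theorem theorem2 (d n : ℕ) (hn : 1 < n) (δ : ℝ) (hδ : δ ∈ Set.Ioo (0 : ℝ) 1)
    (ξ : Measure (Simplex d)) [IsProbabilityMeasure ξ] (hξ : IsSymmetric ξ)
    (κ : Kernel (unitInterval × Simplex d) (Fin d)) (hκ : IsValidKernel κ)
    (T : (Fin n → unitInterval × Fin d) → Fin 2) (hT : Measurable T)
    (h0 : 1 - δ ≤ (obsLaw n ξ (nullKernel d)).real {x | T x = 0})
    (h1 : 1 - δ ≤ (obsLaw n ξ κ).real {x | T x = 1})
    (ε : ℝ) (hε : ε ∈ Set.Ioo (0 : ℝ) (1 / 2)) :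
    min (extDiv 1 (2 * ∫ p : Simplex d, G 1 (lowPart ε p.1) ∂ξ))
        (extDiv (Real.log (1 / (16 * δ)))
          (16 * (∫ p : Simplex d, G (1 / 2) (highPart ε p.1) ∂ξ) ^ 2))
      ≤ (n : EReal) := by
  have key := one_div_le_error hξ hκ hT h0 h1 ε
  have hh0 : 0 ≤ ∫ p : Simplex d, G 1 (lowPart ε p.1) ∂ξ := by
    refine integral_nonneg fun p => Finset.sum_nonneg fun a _ => ?_
    obtain ⟨h0, h1⟩ := lowPart_mem ε a p
    exact Real.rpow_nonneg (mul_nonneg h0 (sub_nonneg.2 h1)) 1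
  set h := ∫ p : Simplex d, G 1 (lowPart ε p.1) ∂ξ
  set g := ∫ p : Simplex d, G (1 / 2) (highPart ε p.1) ∂ξ
  have hn1 : (1 : ℝ) < n := by exact_mod_cast hn
  -- If `n 𝔼[G¹(P_ε)] > 1 / 2`, the first term of the minimum is below `n`.
  rcases lt_or_ge (1 / 2) (n * h) with hlarge | hsmall
  · refine min_le_of_left_le ?_
    have hpos : 0 < h := by
      rcases hh0.eq_or_lt with h' | h'
      · rw [← h', mul_zero] at hlarge; norm_num at hlarge
      · exact h'
    rw [extDiv, if_neg (by positivity), ← EReal.coe_natCast, EReal.coe_le_coe_iff,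
      div_le_iff₀ (by positivity)]
    linarith
  · refine min_le_of_right_le ?_
    have hδ' := key (by nlinarith) hsmall
    have hexp : (1 + g ^ 2) ^ n ≤ Real.exp (n * g ^ 2) := by
      rw [Real.exp_nat_mul]
      refine pow_le_pow_left₀ (by positivity) ?_ n
      rw [add_comm]; exact Real.add_one_le_exp _
    have hbound : 1 / (16 * δ) < Real.exp (n * g ^ 2) := by
      have hp : 0 < (1 + g ^ 2) ^ n := by positivity
      rw [div_le_iff₀ (by positivity)] at hδ'
      rw [div_lt_iff₀ (by linarith [hδ.1])]
      nlinarith [mul_le_mul_of_nonneg_left hexp hδ.1.le]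
    have hlog : Real.log (1 / (16 * δ)) < n * g ^ 2 := by
      rw [Real.log_lt_iff_lt_exp (by have := hδ.1; positivity)]
      exact hbound
    rcases eq_or_ne g 0 with hg | hg
    · -- Here `δ > 1 / 16`, so the quotient `log (1 / (16 δ)) / 0` is `-∞`.
      rw [hg] at hlog ⊢
      have hneg : Real.log (1 / (16 * δ)) < 0 := by simpa using hlog
      rw [extDiv, if_pos (by norm_num), if_neg hneg.not_gt, if_pos hneg]
      exact bot_le
    · have hg2 : 0 < g ^ 2 := by positivity
      rw [extDiv, if_neg (by positivity), ← EReal.coe_natCast, EReal.coe_le_coe_iff,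
        div_le_iff₀ (by positivity)]
      nlinarith [mul_pos (zero_lt_one.trans hn1) hg2]
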